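/- Let $K$ be a field and let $E=(E^0,E^1,r,s)$ be a finite directed graph: $E^0$ (vertices) and $E^1$ (edges) are finite sets, $E^0\neq\emptyset$, and $r,s:E^1\to E^0$ are maps (range and source). Assume that $E$ is acyclic, i.e. there is no sequence of edges $\mu_1,\dots,\mu_n$ ($n\ge 1$) with $r(\mu_i)=s(\mu_{i+1})$ for $1\le i<n$, $r(\mu_n)=s(\mu_1)$ and $s(\mu_i)\ne s(\mu_j)$ for $i\neq j$. Call $H\subseteq E^0$ hereditary if $s(e)\in H$ implies $r(e)\in H$ for every $e\in E^1$, and saturated if every $v\in E^0$ with $0<\#s^{-1}(v)<\infty$ and $\{r(e)\mid e\in E^1,\ s(e)=v\}\subseteq H$ belongs to $H$. Assume that the only subsets of $E^0$ that are both hereditary and saturated are $\emptyset$ and $E^0$. Let $L_K(E)$ be the Leavitt path algebra of $E$, i.e. the associative (not necessarily unital) $K$-algebra generated by pairwise orthogonal idempotents $v$ ($v\in E^0$) together with elements $f,f^*$ ($f\in E^1$), subject to the relations $s(f)f=f=f\,r(f)$ and $r(f)f^*=f^*=f^*s(f)$ for $f\in E^1$; $f^*f'=\delta_{f,f'}\,r(f)$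 for $f,f'\in E^1$; and $v=\sum_{f\in E^1,\ s(f)=v}ff^*$ for every $v\in E^0$ for which $s^{-1}(v)$ is non-empty and finite. Then $L_K(E)$ is a simple unital artinian ring; that is, $L_K(E)$ has a multiplicative identity $1\neq 0$, its only two-sided ideals are $\{0\}$ and $L_K(E)$, and it satisfies the descending chain condition both on left ideals and on right ideals. -/

import Mathlib

universe u v w

/-! ### Directed graphs -/

/-- A directed graph with set of vertices `V`, set of edges `E`, and source and range maps
`s, r : E → V` (loops and parallel edges are allowed). -/
structure DirGraph (V : Type u) (E : Type v) where
  /-- The source of an edge. -/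
  s : E → V
  /-- The range of an edge. -/
  r : E → V

namespace DirGraph

variable {V : Type u} {E : Type v} (G : DirGraph V E)

/-- A path (of positive length) is a nonempty sequence of edges `μ₁ … μₙ` such that
`r μᵢ = s μᵢ₊₁` for `1 ≤ i < n`. -/
def IsPath (μ : List E) : Prop :=
  μ ≠ [] ∧ μ.IsChain (fun e f => G.r e = G.s f)

/-- A cycle is a path `μ₁ … μₙ` with `s μ₁ = r μₙ` and `s μᵢ ≠ s μⱼ` for `i ≠ j`. -/
def IsCycle (μ : List E) : Prop :=
  G.IsPath μ ∧ (∀ e ∈ μ.head?, ∀ f ∈ μ.getLast?, G.s e = G.r f) ∧ (μ.map G.s).Nodup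

/-- A graph is acyclic if it has no cycles. -/
def IsAcyclic : Prop := ∀ μ : List E, ¬ G.IsCycle μ

/-- A set `H` of vertices is hereditary if `s e ∈ H` implies `r e ∈ H` for every edge `e`. -/
def IsHereditary (H : Set V) : Prop := ∀ e : E, G.s e ∈ H → G.r e ∈ H

/-- A set `H` of vertices is saturated if it contains every vertex `v` that emits at least one and
only finitely many edges, all of which have their range in `H`. -/
def IsSaturated (H : Set V) : Prop :=
  ∀ v : V, {e : E | G.s e = v}.Nonempty → {e : E | G.s e = v}.Finite →
    (∀ e : E, G.s e = v → G.r e ∈ H) → v ∈ H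

end DirGraph

/-! ### Leavitt path algebras -/

/-- The symbols `v` (for vertices), `f` and `f*` (for edges). -/
inductive LeavittGen (V : Type u) (E : Type v) : Type max u v
  | vert : V → LeavittGen V E
  | edge : E → LeavittGen V E
  | ghost : E → LeavittGen V E

/-- The free associative, not necessarily unital, `K`-algebra on the symbols `v`, `f`, `f*`: the
`K`-linear combinations of nonempty words in these symbols. -/
abbrev LeavittFree (K : Type w) [Field K] (V : Type u) (E : Type v) : Type max u v w :=
  MonoidAlgebra K (FreeSemigroup (LeavittGen V E))

namespace LeavittFree

variable (K : Type w) [Field K] {V : Type u} {E : Type v}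

/-- A symbol as an element of the free algebra. -/
noncomputable def gen (x : LeavittGen V E) : LeavittFree K V E :=
  MonoidAlgebra.single (FreeSemigroup.of x) 1

/-- A vertex as an element of the free algebra. -/
noncomputable def vert (x : V) : LeavittFree K V E := gen K (LeavittGen.vert x)

/-- An edge as an element of the free algebra. -/
noncomputable def edge (f : E) : LeavittFree K V E := gen K (LeavittGen.edge f)

/-- A ghost edge `f*` as an element of the free algebra. -/
noncomputable def ghost (f : E) : LeavittFree K V E := gen K (LeavittGen.ghost f)

end LeavittFree

open LeavittFree in
/-- The defining relations `a = b` of the Leavitt path algebra of a graph. -/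
inductive LeavittRel (K : Type w) [Field K] {V : Type u} {E : Type v} (G : DirGraph V E) :
    LeavittFree K V E → LeavittFree K V E → Prop
  | vert_idem (x : V) : LeavittRel K G (vert K x * vert K x) (vert K x)
  | vert_orth (x y : V) (h : x ≠ y) : LeavittRel K G (vert K x * vert K y) 0
  | source_edge (f : E) : LeavittRel K G (vert K (G.s f) * edge K f) (edge K f)
  | edge_range (f : E) : LeavittRel K G (edge K f * vert K (G.r f)) (edge K f)
  | range_ghost (f : E) : LeavittRel K G (vert K (G.r f) * ghost K f) (ghost K f)
  | ghost_source (f : E) : LeavittRel K G (ghost K f * vert K (G.s f)) (ghost K f)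
  | ghost_edge_same (f : E) : LeavittRel K G (ghost K f * edge K f) (vert K (G.r f))
  | ghost_edge_ne (f g : E) (h : f ≠ g) : LeavittRel K G (ghost K f * edge K g) 0
  | vert_sum (x : V) (hne : {f : E | G.s f = x}.Nonempty) (hfin : {f : E | G.s f = x}.Finite) :
      LeavittRel K G (vert K x) (∑ f ∈ hfin.toFinset, edge K f * ghost K f)

/-- The two-sided ideal, closed under multiplication by scalars, generated by the elements `a - b`
for all defining relations `a = b`. As the free algebra has no identity, the scalar multiples of
these elements have to be included among the generators. -/
noncomputable def leavittIdeal (K : Type w) [Field K] {V : Type u} {E : Type v}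
    (G : DirGraph V E) : TwoSidedIdeal (LeavittFree K V E) :=
  TwoSidedIdeal.span {x | ∃ (k : K) (a b : LeavittFree K V E), LeavittRel K G a b ∧
    x = k • (a - b)}

/-- The Leavitt path algebra of the graph `G` with coefficients in the field `K`: the associative,
not necessarily unital, `K`-algebra presented by the symbols `v`, `f`, `f*` and the defining
relations. -/
def LeavittPathAlgebra (K : Type w) [Field K] {V : Type u} {E : Type v} (G : DirGraph V E) :
    Type max u v w :=
  (leavittIdeal K G).ringCon.Quotient

namespace LeavittPathAlgebra

variable (K : Type w) [Field K] {V : Type u} {E : Type v} (G : DirGraph V E)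

noncomputable instance : NonUnitalRing (LeavittPathAlgebra K G) :=
  inferInstanceAs (NonUnitalRing (leavittIdeal K G).ringCon.Quotient)

/-- The quotient map from the free algebra, as a ring homomorphism. -/
noncomputable def mk : LeavittFree K V E →ₙ+* LeavittPathAlgebra K G where
  toFun a := ((a : (leavittIdeal K G).ringCon.Quotient))
  map_zero' := rfl
  map_add' _ _ := rfl
  map_mul' _ _ := rfl

theorem mk_surjective : Function.Surjective (mk K G) := Quotient.mk''_surjective

theorem mk_eq_mk {a b : LeavittFree K V E} :
    mk K G a = mk K G b ↔ a - b ∈ leavittIdeal K G := by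
  rw [← TwoSidedIdeal.rel_iff]
  exact RingCon.eq _

theorem smul_mem (k : K) {a : LeavittFree K V E} (ha : a ∈ leavittIdeal K G) :
    k • a ∈ leavittIdeal K G := by
  induction ha using TwoSidedIdeal.span_induction with
  | mem x hx =>
    obtain ⟨l, a, b, hab, rfl⟩ := hx
    exact TwoSidedIdeal.subset_span ⟨k * l, a, b, hab, smul_smul k l _⟩
  | zero => rw [smul_zero]; exact TwoSidedIdeal.zero_mem _
  | add x y _ _ hx hy => rw [smul_add]; exact TwoSidedIdeal.add_mem _ hx hy
  | neg x _ hx => rw [smul_neg]; exact TwoSidedIdeal.neg_mem _ hx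
  | left_absorb a x _ hx => rw [← mul_smul_comm]; exact TwoSidedIdeal.mul_mem_left _ _ _ hx
  | right_absorb b x _ hx => rw [← smul_mul_assoc]; exact TwoSidedIdeal.mul_mem_right _ _ _ hx

noncomputable instance : SMul K (LeavittPathAlgebra K G) where
  smul k := Quotient.map' (fun a => k • a) fun a b h => by
    have h' : a - b ∈ leavittIdeal K G := (TwoSidedIdeal.rel_iff _ a b).1 h
    refine (TwoSidedIdeal.rel_iff _ (k • a) (k • b)).2 ?_
    rw [← smul_sub]
    exact smul_mem K G k h'

theorem mk_smul (k : K) (a : LeavittFree K V E) : mk K G (k • a) = k • mk K G a := rfl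

noncomputable instance : Module K (LeavittPathAlgebra K G) :=
  Function.Surjective.module K (mk K G : LeavittFree K V E →+ LeavittPathAlgebra K G)
    (mk_surjective K G) (mk_smul K G)

instance : IsScalarTower K (LeavittPathAlgebra K G) (LeavittPathAlgebra K G) where
  smul_assoc k x y := by
    obtain ⟨a, rfl⟩ := mk_surjective K G x
    obtain ⟨b, rfl⟩ := mk_surjective K G y
    simp only [smul_eq_mul, ← mk_smul, ← map_mul, smul_mul_assoc]

instance : SMulCommClass K (LeavittPathAlgebra K G) (LeavittPathAlgebra K G) where
  smul_comm k x y := by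
    obtain ⟨a, rfl⟩ := mk_surjective K G x
    obtain ⟨b, rfl⟩ := mk_surjective K G y
    simp only [smul_eq_mul, ← mk_smul, ← map_mul, mul_smul_comm]

end LeavittPathAlgebra

/-! ### Rings without a specified identity -/

/-- A ring is unital if it has a nonzero two-sided multiplicative identity. -/
def IsUnitalRing (R : Type u) [NonUnitalRing R] : Prop :=
  ∃ e : R, e ≠ 0 ∧ ∀ x : R, e * x = x ∧ x * e = x

/-- The left ideals of a ring: the additive subgroups closed under left multiplication. -/
abbrev LeftIdealOf (R : Type u) [NonUnitalRing R] : Type u :=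
  {N : AddSubgroup R // ∀ r : R, ∀ n ∈ N, r * n ∈ N}

/-- The right ideals of a ring: the additive subgroups closed under right multiplication. -/
abbrev RightIdealOf (R : Type u) [NonUnitalRing R] : Type u :=
  {N : AddSubgroup R // ∀ r : R, ∀ n ∈ N, n * r ∈ N}

/-- A ring is artinian if its left ideals and its right ideals, ordered by inclusion, both satisfy
the descending chain condition. -/
def IsTwoSidedArtinian (R : Type u) [NonUnitalRing R] : Prop :=
  WellFoundedLT (LeftIdealOf R) ∧ WellFoundedLT (RightIdealOf R)

/-! The algebra is a full matrix algebra over `K`. A finite acyclic graph has a sink `t`, and the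
vertices from which no other sink can be reached form a hereditary saturated set containing `t`;
hence `t` is the only sink. Acyclicity also leaves only finitely many paths ending in `t`.

For such paths the elements `p q*` multiply as matrix units, because `t` emits no edge
(`ghostElt_mul_pathElt_ne`). They span: expanding a vertex by `v = ∑ f f*` again and again must end
at `t` (`vert_mem_unitSpan`, `unitSpan_eq_top`). They are independent because `t` is nonzero in the
algebra, as an explicit representation on functions of paths shows (`mk_vert_ne_zero`). So
`ofMatrix` is an isomorphism, which yields simplicity and the identity; finite dimension over `K`
yields both chain conditions. -/

namespace DirGraph

/-! ### Paths and sinks in acyclic graphs -/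

variable {V : Type u} {E : Type v} (G : DirGraph V E)

/-- A vertex is a sink if it emits no edge. -/
def IsSink (t : V) : Prop := ∀ e : E, G.s e ≠ t

/-- The source of a path ending in `t`, where the empty list is the trivial path at `t`. -/
def src (t : V) : List E → V
  | [] => t
  | e :: _ => G.s e

/-- The list of edges is a path ending in `t`, where the empty list is the trivial path at `t`. -/
def IsPathTo (t : V) : List E → Prop
  | [] => True
  | e :: l => G.r e = G.src t l ∧ IsPathTo t l

variable {G}

theorem IsPathTo.isChain {t : V} {l : List E} (h : G.IsPathTo t l) :
    l.IsChain (fun e f => G.r e = G.s f) := by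
  induction l with
  | nil => exact .nil
  | cons e l ih =>
    refine List.isChain_cons.2 ⟨?_, ih h.2⟩
    intro f hf
    cases l with
    | nil => simp at hf
    | cons g l =>
      simp only [List.head?_cons, Option.mem_def, Option.some.injEq] at hf
      exact hf ▸ h.1

/-- If the first source recurs, the segment before its recurrence is closed; it is shorter, so by
induction its sources are distinct and it is a cycle. -/
theorem IsAcyclic.nodup_map_s (hG : G.IsAcyclic) (l : List E)
    (hl : l.IsChain (fun e f => G.r e = G.s f)) : (l.map G.s).Nodup := by
  induction hn : l.length using Nat.strong_induction_on generalizing l with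
  | _ n ih =>
    subst hn
    cases l with
    | nil => simp
    | cons e l =>
      rw [List.map_cons, List.nodup_cons]
      refine ⟨fun hmem => ?_, ih l.length (by simp) l (List.isChain_cons.1 hl).2 rfl⟩
      obtain ⟨f, hf, hfe⟩ := List.mem_map.1 hmem
      obtain ⟨b, c, rfl⟩ := List.append_of_mem hf
      rw [← List.cons_append, List.isChain_append] at hl
      refine hG (e :: b) ⟨⟨by simp, hl.1⟩, ?_, ih _ (by simp) _ hl.1 rfl⟩
      intro e' he' g hg
      simp only [List.head?_cons, Option.mem_def, Option.some.injEq] at he'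
      rw [← he', hl.2.2 g hg f (by simp), hfe]

theorem IsAcyclic.finite_isPathTo [Finite E] (hG : G.IsAcyclic) (t : V) :
    Finite {l : List E // G.IsPathTo t l} := by
  classical
  have := Fintype.ofFinite E
  exact Finite.of_injective
    (fun l => (⟨l.1, (hG.nodup_map_s l.1 l.2.isChain).of_map G.s⟩ : {l : List E // l.Nodup}))
    fun a b h => Subtype.ext (congrArg (fun x => x.1) h)

theorem exists_isPath_of_transGen {a b : V}
    (h : Relation.TransGen (fun a b => ∃ e, G.s e = b ∧ G.r e = a) a b) :
    ∃ μ : List E, G.IsPath μ ∧ (∀ e ∈ μ.head?, G.s e = b) ∧ ∀ e ∈ μ.getLast?, G.r e = a := by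
  induction h with
  | single h =>
    obtain ⟨e, he, he'⟩ := h
    exact ⟨[e], ⟨by simp, .singleton e⟩, by simpa using he, by simpa using he'⟩
  | tail _ h ih =>
    obtain ⟨e, he, he'⟩ := h
    obtain ⟨μ, ⟨hne, hc⟩, h1, h2⟩ := ih
    refine ⟨e :: μ, ⟨by simp, List.isChain_cons.2 ⟨fun f hf => ?_, hc⟩⟩, by simpa using he, ?_⟩
    · rw [he', h1 f hf]
    · cases μ with
      | nil => exact absurd rfl hne
      | cons f l => simpa [List.getLast?_cons] using h2

theorem IsAcyclic.wellFounded [Finite V] (hG : G.IsAcyclic) :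
    WellFounded (fun a b => ∃ e, G.s e = b ∧ G.r e = a) := by
  have : Std.Irrefl (Relation.TransGen (fun a b => ∃ e, G.s e = b ∧ G.r e = a)) := ⟨fun a h => by
    obtain ⟨μ, hμ, h1, h2⟩ := exists_isPath_of_transGen h
    -- A closed path is already a cycle, since distinctness of sources is automatic.
    exact hG μ ⟨hμ, fun e he f hf => (h1 e he).trans (h2 f hf).symm, hG.nodup_map_s μ hμ.2⟩⟩
  exact Subrelation.wf (fun h => Relation.TransGen.single h)
    (Finite.wellFounded_of_trans_of_irrefl
      (Relation.TransGen (fun a b => ∃ e, G.s e = b ∧ G.r e = a)))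

theorem IsAcyclic.exists_isSink [Finite V] [Nonempty V] (hG : G.IsAcyclic) :
    ∃ t, G.IsSink t := by
  obtain ⟨t, -, ht⟩ := hG.wellFounded.has_min Set.univ Set.univ_nonempty
  exact ⟨t, fun e he => ht (G.r e) trivial ⟨e, he, rfl⟩⟩

theorem IsSink.eq_of_hereditary_saturated
    (hHS : ∀ H : Set V, G.IsHereditary H → G.IsSaturated H → H = ∅ ∨ H = Set.univ)
    {t u : V} (ht : G.IsSink t) (hu : G.IsSink u) : u = t := by
  let R : V → V → Prop := fun a b => ∃ e, G.s e = a ∧ G.r e = b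
  -- The set of vertices that reach no sink other than `t`.
  have key := hHS {v | ∀ u, G.IsSink u → Relation.ReflTransGen R v u → u = t}
    (fun e he u hu h => he u hu (.head ⟨e, rfl, rfl⟩ h))
    (fun v ⟨e, he⟩ _ hv u hu h => by
      rcases h.cases_head with rfl | ⟨b, ⟨f, hf, rfl⟩, hb⟩
      · exact absurd he (hu e)
      · exact hv f hf u hu hb)
  rcases key with h | h
  · refine absurd ?_ (Set.eq_empty_iff_forall_notMem.1 h t)
    intro u _ hu
    rcases hu.cases_head with rfl | ⟨b, ⟨f, hf, rfl⟩, -⟩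
    · rfl
    · exact absurd hf (ht f)
  · exact (Set.eq_univ_iff_forall.1 h u) u hu .refl

end DirGraph


namespace LeavittPathAlgebra

variable {K : Type w} [Field K] {V : Type u} {E : Type v} {G : DirGraph V E}

theorem mk_eq_of_rel {a b : LeavittFree K V E} (h : LeavittRel K G a b) : mk K G a = mk K G b :=
  (mk_eq_mk K G).2 (TwoSidedIdeal.subset_span ⟨1, a, b, h, (one_smul K _).symm⟩)

/-! ### Nontriviality -/

section Representation

open Classical in
/-- The action of the symbols on functions on lists of edges, read as paths ending in `t`. -/
noncomputable def genAct (K : Type w) [Field K] (G : DirGraph V E) (t : V) :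
    LeavittGen V E → Module.End K (List E → K)
  | .vert x =>
    { toFun g p := if G.IsPathTo t p ∧ G.src t p = x then g p else 0
      map_add' g h := by ext p; simp only [Pi.add_apply]; split_ifs <;> simp
      map_smul' k g := by ext p; simp }
  | .edge f =>
    { toFun g p := if p.head? = some f ∧ G.IsPathTo t p then g p.tail else 0
      map_add' g h := by ext p; simp only [Pi.add_apply]; split_ifs <;> simp
      map_smul' k g := by ext p; simp }
  | .ghost f =>
    { toFun g p := if G.IsPathTo t (f :: p) then g (f :: p) else 0
      map_add' g h := by ext p; simp only [Pi.add_apply]; split_ifs <;> simp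
      map_smul' k g := by ext p; simp }

/-- The action of the free algebra on functions on lists of edges. -/
noncomputable def freeAct (K : Type w) [Field K] (G : DirGraph V E) (t : V) :
    LeavittFree K V E →ₙₐ[K] Module.End K (List E → K) :=
  MonoidAlgebra.liftMagma K (FreeSemigroup.lift (genAct K G t))

theorem freeAct_gen (t : V) (x : LeavittGen V E) :
    freeAct K G t (LeavittFree.gen K x) = genAct K G t x := by
  simp [freeAct, LeavittFree.gen]

open Classical in
theorem freeAct_vert (t x : V) (g : List E → K) (p : List E) :
    freeAct K G t (LeavittFree.vert K x) g p =
      if G.IsPathTo t p ∧ G.src t p = x then g p else 0 := by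
  rw [LeavittFree.vert, freeAct_gen]; rfl

open Classical in
theorem freeAct_edge (t : V) (f : E) (g : List E → K) (p : List E) :
    freeAct K G t (LeavittFree.edge K f) g p =
      if p.head? = some f ∧ G.IsPathTo t p then g p.tail else 0 := by
  rw [LeavittFree.edge, freeAct_gen]; rfl

open Classical in
theorem freeAct_ghost (t : V) (f : E) (g : List E → K) (p : List E) :
    freeAct K G t (LeavittFree.ghost K f) g p =
      if G.IsPathTo t (f :: p) then g (f :: p) else 0 := by
  rw [LeavittFree.ghost, freeAct_gen]; rfl

/-- Edges strip and ghost edges prepend an edge in the argument of a function. In `vert_sum` only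
the summand of the first edge of `p` survives; the trivial path has none, and is harmless because a
sink is subject to no such relation. -/
theorem freeAct_rel {t : V} (ht : G.IsSink t) {a b : LeavittFree K V E}
    (h : LeavittRel K G a b) : freeAct K G t a = freeAct K G t b := by
  classical
  ext1 g
  funext p
  cases h with
  | vert_sum x hne hfin =>
    rw [map_sum, LinearMap.sum_apply, Finset.sum_apply]
    simp only [map_mul, Module.End.mul_apply, freeAct_edge, freeAct_ghost, freeAct_vert]
    cases p with
    | nil =>
      obtain ⟨f, hf⟩ := hne
      have : t ≠ x := fun h => ht f (hf.trans h.symm)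
      simp [DirGraph.src, this]
    | cons e l =>
      by_cases hp : G.IsPathTo t (e :: l)
      · by_cases he : G.s e = x
        · rw [Finset.sum_eq_single e]
          · simp [hp, DirGraph.src, he]
          · intro f _ hf
            simp [hf.symm]
          · intro h
            exact absurd (hfin.mem_toFinset.2 he) h
        · rw [Finset.sum_eq_zero]
          · simp [DirGraph.src, he]
          · intro f hf
            have : e ≠ f := by
              rintro rfl
              exact he (hfin.mem_toFinset.1 hf)
            simp [this]
      · simp [hp]
  | vert_idem x => simp +contextual [freeAct_vert]
  | vert_orth x y hxy =>
    simp only [map_mul, Module.End.mul_apply, freeAct_vert, map_zero, LinearMap.zero_apply,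
      Pi.zero_apply]
    grind
  | source_edge f =>
    cases p <;> simp +contextual [freeAct_vert, freeAct_edge, DirGraph.src]
    grind
  | edge_range f =>
    cases p <;> simp +contextual [freeAct_vert, freeAct_edge, DirGraph.IsPathTo]
    grind
  | range_ghost f =>
    simp +contextual [freeAct_vert, freeAct_ghost, DirGraph.IsPathTo]
    grind
  | ghost_source f =>
    simp +contextual [freeAct_vert, freeAct_ghost, DirGraph.src]
  | ghost_edge_same f =>
    simp +contextual [freeAct_vert, freeAct_ghost, freeAct_edge, DirGraph.IsPathTo]
    grind
  | ghost_edge_ne f f' hf =>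
    simp +contextual [freeAct_ghost, freeAct_edge, hf]

theorem freeAct_eq_zero_of_mem {t : V} (ht : G.IsSink t) {a : LeavittFree K V E}
    (ha : a ∈ leavittIdeal K G) : freeAct K G t a = 0 := by
  induction ha using TwoSidedIdeal.span_induction with
  | mem x hx =>
    obtain ⟨k, a, b, hab, rfl⟩ := hx
    rw [map_smul, map_sub, freeAct_rel ht hab, sub_self, smul_zero]
  | zero => exact map_zero _
  | add x y _ _ hx hy => rw [map_add, hx, hy, add_zero]
  | neg x _ hx => rw [map_neg, hx, neg_zero]
  | left_absorb a x _ hx => rw [map_mul, hx, mul_zero]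
  | right_absorb b x _ hx => rw [map_mul, hx, zero_mul]

theorem mk_vert_ne_zero {t : V} (ht : G.IsSink t) : mk K G (LeavittFree.vert K t) ≠ 0 := by
  intro h
  rw [← map_zero (mk K G), mk_eq_mk, sub_zero] at h
  -- The vertex `t` fixes the value 1 of the constant function at the trivial path.
  have := congrFun (LinearMap.congr_fun (freeAct_eq_zero_of_mem ht h) (fun _ => 1)) []
  simp [freeAct_vert, DirGraph.IsPathTo, DirGraph.src] at this

end Representation

/-! ### Matrix units -/

open LeavittFree

/-- The element given by a path ending in `t`. -/
noncomputable def pathElt (K : Type w) [Field K] (G : DirGraph V E) (t : V) :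
    List E → LeavittPathAlgebra K G
  | [] => mk K G (vert K t)
  | e :: l => mk K G (edge K e) * pathElt K G t l

/-- The element `p*` given by a path `p` ending in `t`. -/
noncomputable def ghostElt (K : Type w) [Field K] (G : DirGraph V E) (t : V) :
    List E → LeavittPathAlgebra K G
  | [] => mk K G (vert K t)
  | e :: l => ghostElt K G t l * mk K G (ghost K e)

theorem mk_vert_mul_vert (x : V) :
    mk K G (vert K x) * mk K G (vert K x) = mk K G (vert K x) := by
  rw [← map_mul, mk_eq_of_rel (.vert_idem x)]

theorem mk_vert_mul_vert_ne {x y : V} (h : x ≠ y) :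
    mk K G (vert K x) * mk K G (vert K y) = 0 := by
  rw [← map_mul, mk_eq_of_rel (.vert_orth x y h), map_zero]

theorem mk_source_mul_edge (f : E) :
    mk K G (vert K (G.s f)) * mk K G (edge K f) = mk K G (edge K f) := by
  rw [← map_mul, mk_eq_of_rel (.source_edge f)]

theorem mk_edge_mul_range (f : E) :
    mk K G (edge K f) * mk K G (vert K (G.r f)) = mk K G (edge K f) := by
  rw [← map_mul, mk_eq_of_rel (.edge_range f)]

theorem mk_range_mul_ghost (f : E) :
    mk K G (vert K (G.r f)) * mk K G (ghost K f) = mk K G (ghost K f) := by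
  rw [← map_mul, mk_eq_of_rel (.range_ghost f)]

theorem mk_ghost_mul_source (f : E) :
    mk K G (ghost K f) * mk K G (vert K (G.s f)) = mk K G (ghost K f) := by
  rw [← map_mul, mk_eq_of_rel (.ghost_source f)]

theorem mk_ghost_mul_edge (f : E) :
    mk K G (ghost K f) * mk K G (edge K f) = mk K G (vert K (G.r f)) := by
  rw [← map_mul, mk_eq_of_rel (.ghost_edge_same f)]

theorem mk_ghost_mul_edge_ne {f g : E} (h : f ≠ g) :
    mk K G (ghost K f) * mk K G (edge K g) = 0 := by
  rw [← map_mul, mk_eq_of_rel (.ghost_edge_ne f g h), map_zero]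

theorem mk_vert_mul_edge_ne {x : V} {f : E} (h : x ≠ G.s f) :
    mk K G (vert K x) * mk K G (edge K f) = 0 := by
  rw [← mk_source_mul_edge, ← mul_assoc, mk_vert_mul_vert_ne h, zero_mul]

theorem mk_ghost_mul_vert_ne {x : V} {f : E} (h : G.s f ≠ x) :
    mk K G (ghost K f) * mk K G (vert K x) = 0 := by
  rw [← mk_ghost_mul_source, mul_assoc, mk_vert_mul_vert_ne h, mul_zero]

theorem src_mul_pathElt (t : V) (l : List E) :
    mk K G (vert K (G.src t l)) * pathElt K G t l = pathElt K G t l := by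
  cases l with
  | nil => exact mk_vert_mul_vert t
  | cons e l => rw [pathElt, DirGraph.src, ← mul_assoc, mk_source_mul_edge]

theorem ghostElt_mul_src (t : V) (l : List E) :
    ghostElt K G t l * mk K G (vert K (G.src t l)) = ghostElt K G t l := by
  cases l with
  | nil => exact mk_vert_mul_vert t
  | cons e l => rw [ghostElt, DirGraph.src, mul_assoc, mk_ghost_mul_source]

theorem vert_mul_pathElt_ne {t x : V} {l : List E} (h : x ≠ G.src t l) :
    mk K G (vert K x) * pathElt K G t l = 0 := by
  rw [← src_mul_pathElt, ← mul_assoc, mk_vert_mul_vert_ne h, zero_mul]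

theorem ghostElt_mul_vert_ne {t x : V} {l : List E} (h : G.src t l ≠ x) :
    ghostElt K G t l * mk K G (vert K x) = 0 := by
  rw [← ghostElt_mul_src, mul_assoc, mk_vert_mul_vert_ne h, mul_zero]

theorem pathElt_mul_sink (t : V) (l : List E) :
    pathElt K G t l * mk K G (vert K t) = pathElt K G t l := by
  induction l with
  | nil => exact mk_vert_mul_vert t
  | cons e l ih => rw [pathElt, mul_assoc, ih]

theorem sink_mul_ghostElt (t : V) (l : List E) :
    mk K G (vert K t) * ghostElt K G t l = ghostElt K G t l := by
  induction l with
  | nil => exact mk_vert_mul_vert t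
  | cons e l ih => rw [ghostElt, ← mul_assoc, ih]

theorem ghostElt_mul_pathElt {t : V} {p : List E} (hp : G.IsPathTo t p) :
    ghostElt K G t p * pathElt K G t p = mk K G (vert K t) := by
  induction p with
  | nil => exact mk_vert_mul_vert t
  | cons e l ih =>
    rw [ghostElt, pathElt, mul_assoc, ← mul_assoc (mk K G (ghost K e)), mk_ghost_mul_edge,
      hp.1, src_mul_pathElt, ih hp.2]

/-- Cancel the common initial segment. Then either two distinct edges meet, or one path is exhausted
and `t` meets an edge it does not emit. -/
theorem ghostElt_mul_pathElt_ne {t : V} (ht : G.IsSink t) {p q : List E} (hp : G.IsPathTo t p)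
    (h : p ≠ q) : ghostElt K G t p * pathElt K G t q = 0 := by
  induction p generalizing q with
  | nil =>
    cases q with
    | nil => exact absurd rfl h
    | cons f m => exact vert_mul_pathElt_ne (ht f).symm
  | cons e l ih =>
    cases q with
    | nil => exact ghostElt_mul_vert_ne (ht e)
    | cons f m =>
      rw [ghostElt, pathElt, mul_assoc, ← mul_assoc (mk K G (ghost K e))]
      by_cases hef : e = f
      · subst hef
        rw [mk_ghost_mul_edge, ← mul_assoc, hp.1, ghostElt_mul_src]
        exact ih hp.2 (fun h' => h (h' ▸ rfl))
      · rw [mk_ghost_mul_edge_ne hef, zero_mul, mul_zero]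

/-- The linear span of the elements `p q*`, for paths `p` and `q` ending in `t`. -/
noncomputable def unitSpan (K : Type w) [Field K] (G : DirGraph V E) (t : V) :
    Submodule K (LeavittPathAlgebra K G) :=
  Submodule.span K {x | ∃ p q, G.IsPathTo t p ∧ G.IsPathTo t q ∧
    x = pathElt K G t p * ghostElt K G t q}

/-- Meant for `a` a generator, which sends each path to a path or to zero. -/
theorem mul_mem_unitSpan {t : V} {a x : LeavittPathAlgebra K G}
    (ha : ∀ p, G.IsPathTo t p →
      a * pathElt K G t p = 0 ∨ ∃ p', G.IsPathTo t p' ∧ a * pathElt K G t p = pathElt K G t p')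
    (hx : x ∈ unitSpan K G t) : a * x ∈ unitSpan K G t := by
  induction hx using Submodule.span_induction with
  | mem x hx =>
    obtain ⟨p, q, hp, hq, rfl⟩ := hx
    rw [← mul_assoc]
    obtain h | ⟨p', hp', h⟩ := ha p hp
    · rw [h, zero_mul]; exact zero_mem _
    · rw [h]; exact Submodule.subset_span ⟨p', q, hp', hq, rfl⟩
  | zero => rw [mul_zero]; exact zero_mem _
  | add x y _ _ hx hy => rw [mul_add]; exact add_mem hx hy
  | smul k x _ hx => rw [mul_smul_comm]; exact Submodule.smul_mem _ k hx

theorem vert_mul_mem_unitSpan {t : V} (y : V) {x : LeavittPathAlgebra K G}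
    (hx : x ∈ unitSpan K G t) : mk K G (vert K y) * x ∈ unitSpan K G t := by
  refine mul_mem_unitSpan (fun p hp => ?_) hx
  by_cases h : y = G.src t p
  · exact .inr ⟨p, hp, by rw [h, src_mul_pathElt]⟩
  · exact .inl (vert_mul_pathElt_ne h)

theorem edge_mul_mem_unitSpan {t : V} (f : E) {x : LeavittPathAlgebra K G}
    (hx : x ∈ unitSpan K G t) : mk K G (edge K f) * x ∈ unitSpan K G t := by
  refine mul_mem_unitSpan (fun p hp => ?_) hx
  by_cases h : G.r f = G.src t p
  · exact .inr ⟨f :: p, ⟨h, hp⟩, rfl⟩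
  · left
    rw [← mk_edge_mul_range, mul_assoc, vert_mul_pathElt_ne h, mul_zero]

theorem ghost_mul_mem_unitSpan {t : V} (ht : G.IsSink t) (f : E) {x : LeavittPathAlgebra K G}
    (hx : x ∈ unitSpan K G t) : mk K G (ghost K f) * x ∈ unitSpan K G t := by
  refine mul_mem_unitSpan (fun p hp => ?_) hx
  cases p with
  | nil => exact .inl (mk_ghost_mul_vert_ne (ht f))
  | cons e l =>
    rw [pathElt, ← mul_assoc]
    by_cases h : f = e
    · subst h
      exact .inr ⟨l, hp.2, by rw [mk_ghost_mul_edge, hp.1, src_mul_pathElt]⟩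
    · rw [mk_ghost_mul_edge_ne h, zero_mul]
      exact .inl rfl

theorem mul_ghost_mem_unitSpan {t : V} (f : E) {x : LeavittPathAlgebra K G}
    (hx : x ∈ unitSpan K G t) : x * mk K G (ghost K f) ∈ unitSpan K G t := by
  induction hx using Submodule.span_induction with
  | mem x hx =>
    obtain ⟨p, q, hp, hq, rfl⟩ := hx
    rw [mul_assoc]
    by_cases h : G.r f = G.src t q
    · exact Submodule.subset_span ⟨p, f :: q, hp, ⟨h, hq⟩, rfl⟩
    · rw [← mk_range_mul_ghost, ← mul_assoc (ghostElt K G t q),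
        ghostElt_mul_vert_ne (Ne.symm h), zero_mul, mul_zero]
      exact zero_mem _
  | zero => rw [zero_mul]; exact zero_mem _
  | add x y _ _ hx hy => rw [add_mul]; exact add_mem hx hy
  | smul k x _ hx => rw [smul_mul_assoc]; exact Submodule.smul_mem _ k hx

/-- Induction along edges: `x = ∑ f r(f) f*`, where each `r(f)` is already in the span. -/
theorem vert_mem_unitSpan [Finite V] [Finite E] (hG : G.IsAcyclic) {t : V}
    (ht : ∀ u, G.IsSink u → u = t) (x : V) : mk K G (vert K x) ∈ unitSpan K G t := by
  induction x using hG.wellFounded.induction with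
  | _ x ih =>
    by_cases hx : G.IsSink x
    · rw [ht x hx]
      exact Submodule.subset_span ⟨[], [], trivial, trivial, (mk_vert_mul_vert t).symm⟩
    · obtain ⟨e, he⟩ : ∃ e, G.s e = x := by simpa [DirGraph.IsSink] using hx
      have hfin : {f : E | G.s f = x}.Finite := Set.toFinite _
      rw [mk_eq_of_rel (.vert_sum x ⟨e, he⟩ hfin), map_sum]
      refine sum_mem fun f hf => ?_
      rw [map_mul, ← mk_edge_mul_range]
      exact mul_ghost_mem_unitSpan f (edge_mul_mem_unitSpan f
        (ih _ ⟨f, hfin.mem_toFinset.1 hf, rfl⟩))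

theorem gen_mul_mem_unitSpan {t : V} (ht : G.IsSink t) (g : LeavittGen V E)
    {x : LeavittPathAlgebra K G} (hx : x ∈ unitSpan K G t) :
    mk K G (gen K g) * x ∈ unitSpan K G t := by
  cases g with
  | vert y => exact vert_mul_mem_unitSpan y hx
  | edge f => exact edge_mul_mem_unitSpan f hx
  | ghost f => exact ghost_mul_mem_unitSpan ht f hx

theorem unitSpan_eq_top [Finite V] [Finite E] (hG : G.IsAcyclic) {t : V} (ht : G.IsSink t)
    (huniq : ∀ u, G.IsSink u → u = t) : unitSpan K G t = ⊤ := by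
  have hgen (g : LeavittGen V E) : mk K G (gen K g) ∈ unitSpan K G t := by
    cases g with
    | vert y => exact vert_mem_unitSpan hG huniq y
    | edge f =>
      have := edge_mul_mem_unitSpan f (vert_mem_unitSpan (K := K) hG huniq (G.r f))
      rwa [mk_edge_mul_range] at this
    | ghost f =>
      have := ghost_mul_mem_unitSpan ht f (vert_mem_unitSpan (K := K) hG huniq (G.s f))
      rwa [mk_ghost_mul_source] at this
  -- Words are built up by left multiplication by generators, which preserves the span.
  have hword (m : FreeSemigroup (LeavittGen V E)) :
      mk K G (MonoidAlgebra.single m 1) ∈ unitSpan K G t := by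
    induction m using FreeSemigroup.recOnMul with
    | ih1 g => exact hgen g
    | ih2 g m _ ih =>
      have := gen_mul_mem_unitSpan ht g ih
      rwa [← map_mul, gen, MonoidAlgebra.single_mul_single, one_mul] at this
  refine eq_top_iff.2 fun x _ => ?_
  obtain ⟨a, rfl⟩ := mk_surjective K G x
  induction a using MonoidAlgebra.induction_linear with
  | zero => rw [map_zero]; exact zero_mem _
  | add a b ha hb => rw [map_add]; exact add_mem (ha trivial) (hb trivial)
  | single m k =>
    have : MonoidAlgebra.single m k = k • MonoidAlgebra.single m (1 : K) := by simp
    rw [this, mk_smul]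
    exact Submodule.smul_mem _ k (hword m)

/-! ### The isomorphism with a matrix ring -/

/-- The map from matrices indexed by the paths ending in `t`, sending matrix units to the elements
`p q*`. -/
noncomputable def ofMatrix (K : Type w) [Field K] {t : V} (ht : G.IsSink t)
    [Fintype {l : List E // G.IsPathTo t l}] :
    Matrix {l : List E // G.IsPathTo t l} {l : List E // G.IsPathTo t l} K →ₙ+*
      LeavittPathAlgebra K G where
  toFun A := ∑ p, ∑ q, A p q • (pathElt K G t p.1 * ghostElt K G t q.1)
  map_zero' := by simp
  map_add' A B := by simp [add_smul, Finset.sum_add_distrib]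
  map_mul' A B := by
    have key (p q p' q' : {l : List E // G.IsPathTo t l}) (h : q ≠ p') :
        pathElt K G t p.1 * ghostElt K G t q.1 * (pathElt K G t p'.1 * ghostElt K G t q'.1)
          = 0 := by
      rw [mul_assoc, ← mul_assoc (ghostElt K G t q.1),
        ghostElt_mul_pathElt_ne ht q.2 (fun h' => h (Subtype.ext h')), zero_mul, mul_zero]
    have key' (p q q' : {l : List E // G.IsPathTo t l}) :
        pathElt K G t p.1 * ghostElt K G t q.1 * (pathElt K G t q.1 * ghostElt K G t q'.1)
          = pathElt K G t p.1 * ghostElt K G t q'.1 := by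
      rw [mul_assoc, ← mul_assoc (ghostElt K G t q.1), ghostElt_mul_pathElt q.2,
        sink_mul_ghostElt]
    simp only [Finset.sum_mul, Matrix.mul_apply, Finset.sum_smul]
    refine Finset.sum_congr rfl fun p _ => ?_
    rw [Finset.sum_comm]
    refine Finset.sum_congr rfl fun q _ => ?_
    symm
    -- Only row `q` of the second matrix survives multiplication by `p q*`.
    rw [Finset.mul_sum, Finset.sum_eq_single q]
    · simp only [Finset.mul_sum, smul_mul_smul_comm, key']
    · intro p' _ hp'
      simp only [Finset.mul_sum, smul_mul_smul_comm, key _ _ _ _ hp'.symm, smul_zero,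
        Finset.sum_const_zero]
    · simp

variable {t : V} (ht : G.IsSink t) [Fintype {l : List E // G.IsPathTo t l}]

theorem ofMatrix_apply
    (A : Matrix {l : List E // G.IsPathTo t l} {l : List E // G.IsPathTo t l} K) :
    ofMatrix K ht A = ∑ p, ∑ q, A p q • (pathElt K G t p.1 * ghostElt K G t q.1) := rfl

/-- Compression by `p*` and `q` recovers a matrix entry, hence injectivity. -/
theorem ghostElt_mul_ofMatrix_mul_pathElt
    (A : Matrix {l : List E // G.IsPathTo t l} {l : List E // G.IsPathTo t l} K)
    (p q : {l : List E // G.IsPathTo t l}) :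
    ghostElt K G t p.1 * ofMatrix K ht A * pathElt K G t q.1 = A p q • mk K G (vert K t) := by
  rw [ofMatrix_apply, Finset.mul_sum, Finset.sum_mul, Finset.sum_eq_single p,
    Finset.mul_sum, Finset.sum_mul, Finset.sum_eq_single q]
  · rw [mul_smul_comm, smul_mul_assoc, ← mul_assoc, ghostElt_mul_pathElt p.2,
      sink_mul_ghostElt, ghostElt_mul_pathElt q.2]
  · intro q' _ h
    rw [mul_smul_comm, smul_mul_assoc, ← mul_assoc, mul_assoc,
      ghostElt_mul_pathElt_ne ht q'.2 (fun h' => h (Subtype.ext h')), mul_zero, smul_zero]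
  · simp
  · intro p' _ h
    rw [Finset.mul_sum, Finset.sum_mul]
    refine Finset.sum_eq_zero fun q' _ => ?_
    rw [mul_smul_comm, ← mul_assoc (ghostElt K G t p.1),
      ghostElt_mul_pathElt_ne ht p.2 (fun h' => h (Subtype.ext h'.symm)), zero_mul, smul_zero,
      zero_mul]
  · simp

theorem ofMatrix_injective : Function.Injective (ofMatrix K ht) := by
  refine (injective_iff_map_eq_zero (ofMatrix K ht)).2 fun A hA => ?_
  ext p q
  have h := ghostElt_mul_ofMatrix_mul_pathElt ht A p q
  rw [hA, mul_zero, zero_mul] at h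
  exact (smul_eq_zero.1 h.symm).resolve_right (mk_vert_ne_zero (K := K) ht)

theorem ofMatrix_surjective [Finite V] [Finite E] (hG : G.IsAcyclic)
    (huniq : ∀ u, G.IsSink u → u = t) : Function.Surjective (ofMatrix K ht) := by
  classical
  intro x
  have hx : x ∈ unitSpan K G t := unitSpan_eq_top (K := K) hG ht huniq ▸ Submodule.mem_top
  induction hx using Submodule.span_induction with
  | mem x hx =>
    obtain ⟨p, q, hp, hq, rfl⟩ := hx
    refine ⟨Matrix.single ⟨p, hp⟩ ⟨q, hq⟩ 1, ?_⟩
    simp [ofMatrix_apply, Matrix.single_apply, ite_and, ite_smul]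
  | zero => exact ⟨0, map_zero _⟩
  | add x y _ _ hx hy =>
    obtain ⟨A, rfl⟩ := hx
    obtain ⟨B, rfl⟩ := hy
    exact ⟨A + B, map_add _ A B⟩
  | smul k x _ hx =>
    obtain ⟨A, rfl⟩ := hx
    exact ⟨k • A, by simp [ofMatrix_apply, Finset.smul_sum, smul_smul]⟩

theorem finite_of_isAcyclic [Finite V] [Finite E] (hG : G.IsAcyclic) {t : V} (ht : G.IsSink t)
    (huniq : ∀ u, G.IsSink u → u = t) : Module.Finite K (LeavittPathAlgebra K G) := by
  have := hG.finite_isPathTo t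
  refine ⟨Submodule.fg_def.2 ⟨_, ?_, unitSpan_eq_top hG ht huniq⟩⟩
  refine (Set.finite_range fun x : {l : List E // G.IsPathTo t l} × {l : List E // G.IsPathTo t l} =>
    pathElt K G t x.1.1 * ghostElt K G t x.2.1).subset ?_
  rintro _ ⟨p, q, hp, hq, rfl⟩
  exact ⟨(⟨p, hp⟩, ⟨q, hq⟩), rfl⟩

end LeavittPathAlgebra

/-- A unital algebra of finite dimension over a field is artinian. -/
theorem IsUnitalRing.isTwoSidedArtinian (K : Type w) [Field K] {R : Type u} [NonUnitalRing R]
    [Module K R] [IsScalarTower K R R] [SMulCommClass K R R] [Module.Finite K R]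
    (h : IsUnitalRing R) : IsTwoSidedArtinian R := by
  obtain ⟨e, -, he⟩ := h
  constructor
  · let F : LeftIdealOf R → Submodule K R := fun N =>
      { N.1 with
        smul_mem' k x hx := by
          -- As `k • x = (k • e) * x`, ideals are subspaces, and these satisfy the descending chain
          -- condition.
          have := N.2 (k • e) x hx
          rwa [smul_mul_assoc, (he x).1] at this }
    have hF : StrictMono F := fun M N hMN => hMN
    exact hF.wellFoundedLT
  · let F : RightIdealOf R → Submodule K R := fun N =>
      { N.1 with
        smul_mem' k x hx := by
          have := N.2 (k • e) x hx
          rwa [mul_smul_comm, (he x).2] at this }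
    have hF : StrictMono F := fun M N hMN => hMN
    exact hF.wellFoundedLT

theorem mainTheorem12 {V : Type u} {E : Type v} [Finite V] [Finite E] [Nonempty V]
    (G : DirGraph V E) (hG : G.IsAcyclic)
    (hHS : ∀ H : Set V, G.IsHereditary H → G.IsSaturated H → H = ∅ ∨ H = Set.univ)
    (K : Type w) [Field K] :
    IsSimpleRing (LeavittPathAlgebra K G) ∧ IsUnitalRing (LeavittPathAlgebra K G) ∧
      IsTwoSidedArtinian (LeavittPathAlgebra K G) := by
  classical
  obtain ⟨t, ht⟩ := hG.exists_isSink
  have huniq (u : V) (hu : G.IsSink u) : u = t := ht.eq_of_hereditary_saturated hHS hu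
  have := hG.finite_isPathTo t
  have := Fintype.ofFinite {l : List E // G.IsPathTo t l}
  -- The trivial path makes the matrix ring nonzero.
  have : Nonempty {l : List E // G.IsPathTo t l} := ⟨⟨[], trivial⟩⟩
  let φ := RingEquiv.ofBijective (LeavittPathAlgebra.ofMatrix K ht)
    ⟨LeavittPathAlgebra.ofMatrix_injective ht,
      LeavittPathAlgebra.ofMatrix_surjective ht hG huniq⟩
  have hunital : IsUnitalRing (LeavittPathAlgebra K G) := by
    refine ⟨φ 1, (map_ne_zero_iff φ φ.injective).2 one_ne_zero, fun x => ?_⟩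
    obtain ⟨A, rfl⟩ := φ.surjective x
    rw [← map_mul, ← map_mul, one_mul, mul_one]
    exact ⟨rfl, rfl⟩
  have := LeavittPathAlgebra.finite_of_isAcyclic (K := K) hG ht huniq
  exact ⟨IsSimpleRing.of_ringEquiv φ inferInstance, hunital, hunital.isTwoSidedArtinian K⟩
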